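/- Let $\mathcal X,\mathcal Y$ be Polish spaces with Borel probability measures $\mu,\nu$, and let $\Pi(\mu,\nu)$ be the set of Borel probability measures on $\mathcal X\times\mathcal Y$ with marginals $\mu$ and $\nu$. Let $\sigma:[0,1)\to[0,\infty)$ be bounded, increasing and right-continuous with $\int_0^1\sigma(u)\,du=1$. Let $\gamma_\sigma$ be the finite measure on $[0,1)$ with $\gamma_\sigma([0,u])=\sigma(u)$ for $u\in[0,1)$, and let $\Gamma_\sigma$ be the probability measure on $[0,1)$ with distribution function $u\mapsto(1-u)\sigma(u)+\int_0^u\sigma(v)\,dv$. Let $L:\mathcal X\times\mathcal Y\to\mathbb R$ be upper semicontinuous. Suppose that there are lower semicontinuous functions $A\in\mathcal L^1(\mu)$, $B\in\mathcal L^1(\nu)$ and upper semicontinuous functions $a\in\mathcal L^1(\mu)$, $b\in\mathcal L^1(\nu)$, all real-valued, such that $$a(x)+b(y)\le L(x,y)\le A(x)+B(y)$$ for $\mu$-a.e. $x$ and $\nu$-a.e. $y$, i.e. for all $x$ outside some $\mu$-null set and all $y$ outside some $\nu$-null set. For $\pi\in\Pi(\mu,\nu)$ and $\beta\in\mathcal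 L^1(\gamma_\sigma)$ put $$H(\pi,\beta)=\int_{[0,1)}\Big(\beta(u)+(1-u)^{-1}\,\mathbb E_\pi\big[(L-\beta(u))_+\big]\Big)\,d\Gamma_\sigma(u).$$ Then all these expectations and integrals are well defined and finite, and $$\inf_{\beta\in\mathcal L^1(\gamma_\sigma)}\ \max_{\pi\in\Pi(\mu,\nu)}H(\pi,\beta)\;=\;\max_{\pi\in\Pi(\mu,\nu)}\ \inf_{\beta\in\mathcal L^1(\gamma_\sigma)}H(\pi,\beta),$$ where both maxima are attained: the one on the left for every $\beta\in\mathcal L^1(\gamma_\sigma)$, and the one on the right for some $\pi\in\Pi(\mu,\nu)$. -/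

import Mathlib

open MeasureTheory Set Filter Topology

/-- The function which is `0` on `(-∞, 0)`, equal to `f` on `[0, 1)`, and equal to the constant `c`
on `[1, ∞)`. -/
noncomputable def extendIco (f : ℝ → ℝ) (c : ℝ) (u : ℝ) : ℝ :=
  if u < 0 then 0 else if u < 1 then f u else c

theorem extendIco_monotone {f : ℝ → ℝ} {c : ℝ} (hmono : MonotoneOn f (Ico 0 1))
    (hnonneg : ∀ u ∈ Ico (0 : ℝ) 1, 0 ≤ f u) (hle : ∀ u ∈ Ico (0 : ℝ) 1, f u ≤ c) :
    Monotone (extendIco f c) := by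
  have hc : 0 ≤ c := (hnonneg 0 (by simp)).trans (hle 0 (by simp))
  intro u v huv
  unfold extendIco
  split_ifs with h1 h2 h3 h4 h5 h6 h7 h8
  · exact le_refl _
  · exact hnonneg v ⟨not_lt.1 h2, h3⟩
  · exact hc
  · linarith
  · exact hmono ⟨not_lt.1 h1, h4⟩ ⟨not_lt.1 h5, h6⟩ huv
  · exact hle u ⟨not_lt.1 h1, h4⟩
  · linarith
  · linarith
  · exact le_refl _

theorem extendIco_rightContinuous {f : ℝ → ℝ} {c : ℝ}
    (hright : ∀ u ∈ Ico (0 : ℝ) 1, ContinuousWithinAt f (Ici u) u) (u : ℝ) :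
    ContinuousWithinAt (extendIco f c) (Ici u) u := by
  rcases lt_or_ge u 0 with h | h
  · refine (continuousWithinAt_const (b := (0 : ℝ))).congr_of_eventuallyEq ?_ (by simp [extendIco, h])
    filter_upwards [mem_nhdsWithin_of_mem_nhds (Iio_mem_nhds h)] with v hv
    have hv' : v < 0 := hv
    simp [extendIco, hv']
  · rcases lt_or_ge u 1 with h' | h'
    · refine (hright u ⟨h, h'⟩).congr_of_eventuallyEq ?_ (by simp [extendIco, h', not_lt.2 h])
      filter_upwards [mem_nhdsWithin_of_mem_nhds (Iio_mem_nhds h'), self_mem_nhdsWithin] with v hv hv2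
      have hv' : v < 1 := hv
      have hv3 : ¬ v < 0 := not_lt.2 (h.trans hv2)
      simp [extendIco, hv', hv3]
    · refine (continuousWithinAt_const (b := c)).congr (fun v hv => ?_) ?_
      · have hv1 : ¬ v < 1 := not_lt.2 (h'.trans hv)
        have hv0 : ¬ v < 0 := not_lt.2 (h.trans hv)
        simp [extendIco, hv1, hv0]
      · simp [extendIco, not_lt.2 h, not_lt.2 h']

/-- The distribution function on `ℝ` of a measure concentrated on `[0, 1]`, given by a nonnegative,
increasing, right-continuous function `f` on `[0, 1)` and the total mass `c`. -/
noncomputable def stieltjesIco (f : ℝ → ℝ) (c : ℝ) (hmono : MonotoneOn f (Ico 0 1))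
    (hnonneg : ∀ u ∈ Ico (0 : ℝ) 1, 0 ≤ f u) (hle : ∀ u ∈ Ico (0 : ℝ) 1, f u ≤ c)
    (hright : ∀ u ∈ Ico (0 : ℝ) 1, ContinuousWithinAt f (Ici u) u) : StieltjesFunction ℝ where
  toFun := extendIco f c
  mono' := extendIco_monotone hmono hnonneg hle
  right_continuous' := extendIco_rightContinuous hright

/-- A bounded spectral function `σ : [0, 1) → ℝ₊`: nonnegative, increasing, right-continuous, bounded,
with integral one. It is represented by a function on `ℝ`, of which only the values on `[0, 1)`
matter. -/
structure SpectralFunction where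
  /-- The underlying function. -/
  toFun : ℝ → ℝ
  nonneg : ∀ u ∈ Ico (0 : ℝ) 1, 0 ≤ toFun u
  monotoneOn : MonotoneOn toFun (Ico 0 1)
  rightContinuous : ∀ u ∈ Ico (0 : ℝ) 1, ContinuousWithinAt toFun (Ici u) u
  bounded : BddAbove (toFun '' Ico 0 1)
  integral_eq_one : ∫ u in (0 : ℝ)..1, toFun u = 1

namespace SpectralFunction

/-- The measure `γ_σ` on `[0, 1)` (seen as a measure on `ℝ`) with distribution function `σ`:
`γ_σ ([0, u]) = σ u` for `u ∈ [0, 1)`, so that there is an atom of mass `σ 0` at `0`, and no mass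
outside `[0, 1)`. -/
noncomputable def smallGamma (σ : SpectralFunction) : Measure ℝ :=
  (stieltjesIco σ.toFun (sSup (σ.toFun '' Ico 0 1)) σ.monotoneOn σ.nonneg
    (fun _ hu => le_csSup σ.bounded (mem_image_of_mem _ hu)) σ.rightContinuous).measure

theorem intervalIntegrable (σ : SpectralFunction) :
    IntervalIntegrable σ.toFun volume 0 1 := by
  by_contra h
  have h1 := σ.integral_eq_one
  rw [intervalIntegral.integral_undef h] at h1
  exact zero_ne_one h1

theorem intervalIntegrable_of_mem (σ : SpectralFunction) {u v : ℝ} (hu : u ∈ Icc (0 : ℝ) 1)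
    (hv : v ∈ Icc (0 : ℝ) 1) : IntervalIntegrable σ.toFun volume u v := by
  refine σ.intervalIntegrable.mono_set (uIcc_subset_uIcc ?_ ?_) <;>
    rwa [uIcc_of_le zero_le_one]

theorem mul_le_integral (σ : SpectralFunction) {u v : ℝ} (hu : u ∈ Ico (0 : ℝ) 1) (huv : u ≤ v)
    (hv : v ≤ 1) : (v - u) * σ.toFun u ≤ ∫ t in u..v, σ.toFun t := by
  have h : ∫ _ in u..v, σ.toFun u ≤ ∫ t in u..v, σ.toFun t := by
    refine intervalIntegral.integral_mono_on_of_le_Ioo huv intervalIntegrable_const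
      (σ.intervalIntegrable_of_mem ⟨hu.1, hu.2.le⟩ ⟨hu.1.trans huv, hv⟩) (fun t ht => ?_)
    exact σ.monotoneOn hu ⟨hu.1.trans ht.1.le, ht.2.trans_le hv⟩ ht.1.le
  simpa using h

/-- The function `u ↦ (1 - u) σ(u) + ∫₀ᵘ σ(v) dv`. -/
noncomputable def bigGammaCdf (σ : SpectralFunction) (u : ℝ) : ℝ :=
  (1 - u) * σ.toFun u + ∫ v in (0 : ℝ)..u, σ.toFun v

theorem bigGammaCdf_monotoneOn (σ : SpectralFunction) :
    MonotoneOn σ.bigGammaCdf (Ico 0 1) := by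
  intro u hu v hv huv
  have h0 : (0 : ℝ) ∈ Icc (0 : ℝ) 1 := by simp
  have h1 := intervalIntegral.integral_add_adjacent_intervals
    (σ.intervalIntegrable_of_mem h0 ⟨hu.1, hu.2.le⟩)
    (σ.intervalIntegrable_of_mem ⟨hu.1, hu.2.le⟩ ⟨hv.1, hv.2.le⟩)
  have h2 := σ.mul_le_integral hu huv hv.2.le
  have h3 := mul_le_mul_of_nonneg_left (σ.monotoneOn hu hv huv) (sub_nonneg.2 hv.2.le)
  unfold bigGammaCdf
  rw [← h1]
  linarith

theorem bigGammaCdf_nonneg (σ : SpectralFunction) (u : ℝ) (hu : u ∈ Ico (0 : ℝ) 1) :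
    0 ≤ σ.bigGammaCdf u := by
  have h : 0 ≤ σ.bigGammaCdf 0 := by
    simpa [bigGammaCdf] using σ.nonneg 0 (by simp)
  exact h.trans (σ.bigGammaCdf_monotoneOn (by simp) hu hu.1)

theorem bigGammaCdf_le_one (σ : SpectralFunction) (u : ℝ) (hu : u ∈ Ico (0 : ℝ) 1) :
    σ.bigGammaCdf u ≤ 1 := by
  have h0 : (0 : ℝ) ∈ Icc (0 : ℝ) 1 := by simp
  have h0' : (1 : ℝ) ∈ Icc (0 : ℝ) 1 := by simp
  have h1 := intervalIntegral.integral_add_adjacent_intervals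
    (σ.intervalIntegrable_of_mem h0 ⟨hu.1, hu.2.le⟩)
    (σ.intervalIntegrable_of_mem ⟨hu.1, hu.2.le⟩ h0')
  have h2 := σ.mul_le_integral hu hu.2.le le_rfl
  have h3 := σ.integral_eq_one
  unfold bigGammaCdf
  linarith

theorem bigGammaCdf_rightContinuous (σ : SpectralFunction) (u : ℝ) (hu : u ∈ Ico (0 : ℝ) 1) :
    ContinuousWithinAt σ.bigGammaCdf (Ici u) u := by
  have h0 : (0 : ℝ) ∈ Icc (0 : ℝ) 1 := by simp
  have h0' : (1 : ℝ) ∈ Icc (0 : ℝ) 1 := by simp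
  have hint : ContinuousOn (fun x => ∫ v in (0 : ℝ)..x, σ.toFun v) (uIcc 0 1) :=
    intervalIntegral.continuousOn_primitive_interval' σ.intervalIntegrable (by simp)
  have hint' : ContinuousWithinAt (fun x => ∫ v in (0 : ℝ)..x, σ.toFun v) (Ici u) u := by
    rw [uIcc_of_le zero_le_one] at hint
    refine (hint u ⟨hu.1, hu.2.le⟩).mono_of_mem_nhdsWithin ?_
    filter_upwards [mem_nhdsWithin_of_mem_nhds (Iio_mem_nhds hu.2), self_mem_nhdsWithin]
      with v hv hv2
    exact ⟨hu.1.trans hv2, le_of_lt hv⟩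
  exact (((continuous_const.sub continuous_id).continuousWithinAt).mul
    (σ.rightContinuous u hu)).add hint'

/-- The probability measure `Γ_σ` on `[0, 1)` (seen as a measure on `ℝ`) with distribution function
`u ↦ (1 - u) σ(u) + ∫₀ᵘ σ(v) dv`. -/
noncomputable def bigGamma (σ : SpectralFunction) : Measure ℝ :=
  (stieltjesIco σ.bigGammaCdf 1 σ.bigGammaCdf_monotoneOn σ.bigGammaCdf_nonneg
    σ.bigGammaCdf_le_one σ.bigGammaCdf_rightContinuous).measure

/-- The class `𝓛¹(γ_σ)` of `γ_σ`-integrable functions. -/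
def L1 (σ : SpectralFunction) : Set (ℝ → ℝ) :=
  {β | Integrable β σ.smallGamma}

end SpectralFunction

/-- `Π(μ, ν)`: the probability measures on `X × Y` with marginals `μ` and `ν`. -/
def couplings {X Y : Type*} [MeasurableSpace X] [MeasurableSpace Y]
    (μ : ProbabilityMeasure X) (ν : ProbabilityMeasure Y) : Set (ProbabilityMeasure (X × Y)) :=
  {π | (π : Measure (X × Y)).fst = (μ : Measure X) ∧ (π : Measure (X × Y)).snd = (ν : Measure Y)}

/-- A property of pairs `(x, y)` holds for `μ`-a.e. `x` and `ν`-a.e. `y`: it holds for all `x` and `y`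
outside a `μ`-null set and a `ν`-null set respectively. -/
def ForAEPair {X Y : Type*} [MeasurableSpace X] [MeasurableSpace Y]
    (μ : ProbabilityMeasure X) (ν : ProbabilityMeasure Y) (P : X → Y → Prop) : Prop :=
  ∃ S ∈ ae (μ : Measure X), ∃ T ∈ ae (ν : Measure Y), ∀ x ∈ S, ∀ y ∈ T, P x y

/-- The integrand `u ↦ β(u) + (1 - u)⁻¹ E_π[(L - β(u))₊]`. -/
noncomputable def lossIntegrand {W : Type*} [MeasurableSpace W] (L : W → ℝ)
    (π : ProbabilityMeasure W) (β : ℝ → ℝ) (u : ℝ) : ℝ :=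
  β u + (1 - u)⁻¹ * ∫ w, max (L w - β u) 0 ∂(π : Measure W)

/-- `H(π, β) = ∫ (β(u) + (1 - u)⁻¹ E_π[(L - β(u))₊]) dΓ_σ(u)`. -/
noncomputable def lossH {W : Type*} [MeasurableSpace W] (σ : SpectralFunction) (L : W → ℝ)
    (π : ProbabilityMeasure W) (β : ℝ → ℝ) : ℝ :=
  ∫ u, lossIntegrand L π β u ∂σ.bigGamma

/-! Write `γ`, `Γ` for `smallGamma`, `bigGamma`. By `bigGamma_eq_withDensity`, `dΓ = (1 - u) dγ`,
and this density cancels the singular weight `(1 - u)⁻¹`. Fubini on `π ⊗ γ` then gives `H(π, β) = ∫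
(1 - u) β dγ + ∫ G_β(L) dπ` with `G_β(x) = ∫ (x - β(u))₊ dγ(u)` (`lossH_eq_add_integral`). Hence `H`
is affine in `π` and convex in `β`.

As `γ` is finite, `G_β` is increasing and Lipschitz. So `G_β ∘ L` is upper semicontinuous and, up to
null sets of the marginals, lies below a sum of integrable lower semicontinuous functions of one
variable each. The integral of that sum is the same for all couplings, and the remaining nonpositive
part is handled by portmanteau and Fatou: `H(·, β)` is upper semicontinuous on `couplings μ ν`
(`UpperSemicontinuous.integral_couplings`).

The couplings form a compact set by Prokhorov, which yields both maxima; exchanging `inf` and `sup`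
is a minimax theorem, by Hahn–Banach for finitely many `β` and compactness for all of them. -/

/-! ### A minimax theorem -/

/-- Let `H` be concave-like in the first variable on `K` and convex in the second on `C`. If for each
`β ∈ C` some point of `K` makes `H (·) β` exceed `c`, then for finitely many `β ∈ C` some common point
of `K` makes all the `H (·) β` at least `c`. -/
theorem exists_forall_le_of_convexOn {P V : Type*} [AddCommGroup V] [Module ℝ V] {K : Set P}
    {C : Set V} {H : P → V → ℝ} (hconv : ∀ p ∈ K, ConvexOn ℝ C (H p))
    (hconc : ∀ p ∈ K, ∀ q ∈ K, ∀ a b : ℝ, 0 ≤ a → 0 ≤ b → a + b = 1 →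
      ∃ r ∈ K, ∀ β ∈ C, a * H p β + b * H q β ≤ H r β)
    {c : ℝ} (hc : ∀ β ∈ C, ∃ p ∈ K, c < H p β) (s : Finset C) (hK : K.Nonempty) :
    ∃ p ∈ K, ∀ β ∈ s, c ≤ H p β := by
  classical
  by_contra! hcon
  -- Closing the set of value vectors downwards makes it convex under mere concave-likeness, and
  -- forces the separating functional to have a sign.
  let T : Set (s → ℝ) := {x | ∃ p ∈ K, ∀ i : s, x i ≤ H p (i : C)}
  let U : Set (s → ℝ) := univ.pi fun _ => Ioi c
  have hT : Convex ℝ T := by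
    rintro x ⟨p, hp, hxp⟩ y ⟨q, hq, hyq⟩ a b ha hb hab
    obtain ⟨r, hr, hrC⟩ := hconc p hp q hq a b ha hb hab
    refine ⟨r, hr, fun i => le_trans ?_ (hrC _ (i : C).2)⟩
    simp only [Pi.add_apply, Pi.smul_apply, smul_eq_mul]
    gcongr
    · exact hxp i
    · exact hyq i
  have hU : Convex ℝ U := convex_pi fun _ _ => convex_Ioi c
  have hUo : IsOpen U := isOpen_set_pi finite_univ fun _ _ => isOpen_Ioi
  have hdisj : Disjoint U T := by
    rw [Set.disjoint_left]
    rintro x hxU ⟨p, hp, hxp⟩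
    obtain ⟨β, hβ, hlt⟩ := hcon p hp
    have h1 : c < x ⟨β, hβ⟩ := hxU ⟨β, hβ⟩ (mem_univ _)
    linarith [hxp ⟨β, hβ⟩]
  obtain ⟨f, u, hfU, hfT⟩ := geometric_hahn_banach_open hU hUo hT hdisj
  obtain ⟨p₀, hp₀⟩ := hK
  have hf (x : s → ℝ) : f x = ∑ i, x i * f (Pi.single i 1) := by
    conv_lhs => rw [pi_eq_sum_univ' x]
    simp [map_sum]
  set l : s → ℝ := fun i => - f (Pi.single i 1) with hl
  have hf' (x : s → ℝ) : f x = - ∑ i, l i * x i := by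
    rw [hf, ← Finset.sum_neg_distrib]
    exact Finset.sum_congr rfl fun i _ => by simp [hl, mul_comm]
  -- `T` is stable under lowering a coordinate, so a negative `l i` would drive `f` below `u` on
  -- `T`.
  have hl0 (i : s) : 0 ≤ l i := by
    by_contra! hneg
    set b : s → ℝ := fun j => H p₀ (j : C)
    obtain ⟨n, hn⟩ := exists_nat_gt ((f b - u) / (- l i))
    have hmem : b - (n : ℝ) • (Pi.single i 1 : s → ℝ) ∈ T := by
      refine ⟨p₀, hp₀, fun j => ?_⟩
      have : (0 : ℝ) ≤ (n : ℝ) * (Pi.single i 1 : s → ℝ) j := by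
        by_cases h : j = i
        · subst h; simp
        · simp [h]
      simpa [b] using this
    have h1 := hfT _ hmem
    rw [map_sub, map_smul, smul_eq_mul] at h1
    have h2 : f (Pi.single i 1) = - l i := by simp [hl]
    rw [h2] at h1
    rw [div_lt_iff₀ (by linarith)] at hn
    linarith
  have hle : ∀ p ∈ K, ∀ ε > 0, ∑ i, l i * H p (i : C) < (c + ε) * ∑ i, l i := by
    intro p hp ε hε
    have h1 := hfU (fun _ => c + ε) fun _ _ => by simpa using hε
    have h2 := hfT (fun i => H p (i : C)) ⟨p, hp, fun i => le_rfl⟩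
    rw [hf'] at h1 h2
    rw [← Finset.sum_mul] at h1
    linarith
  have hsum : 0 < ∑ i, l i := by
    refine (Finset.sum_nonneg fun i _ => hl0 i).lt_of_ne' fun h => ?_
    have h1 := hle p₀ hp₀ 1 one_pos
    have h2 : ∀ i, l i = 0 := fun i =>
      (Finset.sum_eq_zero_iff_of_nonneg fun i _ => hl0 i).1 h i (Finset.mem_univ i)
    simp [h2] at h1
  -- The normalized multipliers define a single `β` in `C`. Some `p` exceeds `c` there, so by Jensen
  -- the weighted mean of its values exceeds `c` by a fixed amount, against `hle`.
  obtain ⟨p, hp, hlt⟩ := hc (∑ i, (l i / ∑ j, l j) • ((i : C) : V))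
    (((hconv p₀ hp₀).1).sum_mem (fun i _ => div_nonneg (hl0 i) hsum.le)
      (by rw [← Finset.sum_div, div_self hsum.ne']) fun i _ => (i : C).2)
  have h1 := (hconv p hp).map_sum_le (t := Finset.univ) (w := fun i => l i / ∑ j, l j)
    (p := fun i : s => ((i : C) : V)) (fun i _ => div_nonneg (hl0 i) hsum.le)
    (by rw [← Finset.sum_div, div_self hsum.ne']) fun i _ => (i : C).2
  have h2 : ∑ i : s, (l i / ∑ j, l j) • H p (i : C) = (∑ i, l i * H p (i : C)) / ∑ j, l j := by
    rw [Finset.sum_div]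
    exact Finset.sum_congr rfl fun i _ => by rw [smul_eq_mul]; ring
  rw [h2] at h1
  have h3 := hle p hp _ (sub_pos.2 hlt)
  rw [add_sub_cancel, ← div_lt_iff₀ hsum] at h3
  linarith

/-- A minimax theorem: one variable ranges over a compact set, on which the functions are upper
semicontinuous and concave-like, the other over a convex set, on which they are convex. -/
theorem iInf_iSup_le_iSup_iInf_of_isCompact {P V : Type*} [TopologicalSpace P] [AddCommGroup V]
    [Module ℝ V] {K : Set P} (hKc : IsCompact K) (hK : K.Nonempty) {C : Set V} {H : P → V → ℝ}
    (husc : ∀ β ∈ C, UpperSemicontinuousOn (fun p => H p β) K)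
    (hconv : ∀ p ∈ K, ConvexOn ℝ C (H p))
    (hconc : ∀ p ∈ K, ∀ q ∈ K, ∀ a b : ℝ, 0 ≤ a → 0 ≤ b → a + b = 1 →
      ∃ r ∈ K, ∀ β ∈ C, a * H p β + b * H q β ≤ H r β) :
    (⨅ β ∈ C, ⨆ p ∈ K, (H p β : EReal)) ≤ ⨆ p ∈ K, ⨅ β ∈ C, (H p β : EReal) := by
  refine EReal.ge_of_forall_gt_iff_ge.1 fun c hc => ?_
  have hc' : ∀ β ∈ C, ∃ p ∈ K, c < H p β := by
    intro β hβ
    have h := hc.trans_le (iInf₂_le β hβ)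
    simp only [lt_iSup_iff, EReal.coe_lt_coe_iff] at h
    obtain ⟨p, hp, h⟩ := h
    exact ⟨p, hp, h⟩
  suffices h : (K ∩ ⋂ β ∈ C, (fun p => H p β) ⁻¹' Ici c).Nonempty by
    obtain ⟨p, hp, hpC⟩ := h
    refine le_trans ?_ (le_iSup₂ p hp)
    refine le_iInf₂ fun β hβ => EReal.coe_le_coe_iff.2 ?_
    exact mem_iInter₂.1 hpC β hβ
  -- Superlevel sets of upper semicontinuous functions are relatively closed in the compact `K`, so
  -- finite intersections suffice.
  rw [nonempty_iff_ne_empty, Ne,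
    UpperSemicontinuousOn.inter_biInter_preimage_Ici_eq_empty_iff_exists_finset hKc husc]
  rintro ⟨s, hs⟩
  obtain ⟨p, hp, hpc⟩ := exists_forall_le_of_convexOn hconv hconc hc' s hK
  obtain ⟨β, hβ, hlt⟩ := hs p hp
  exact (hpc β hβ).not_gt hlt

/-! ### The measures `γ_σ` and `Γ_σ` -/

theorem extendIco_of_lt_zero (f : ℝ → ℝ) (c : ℝ) {u : ℝ} (h : u < 0) : extendIco f c u = 0 := by
  simp [extendIco, h]

theorem extendIco_of_mem (f : ℝ → ℝ) (c : ℝ) {u : ℝ} (h : u ∈ Ico (0 : ℝ) 1) :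
    extendIco f c u = f u := by
  simp [extendIco, h.1.not_gt, h.2]

theorem extendIco_of_one_le (f : ℝ → ℝ) (c : ℝ) {u : ℝ} (h : 1 ≤ u) : extendIco f c u = c := by
  simp [extendIco, h.not_gt, (zero_le_one.trans h).not_gt]

section stieltjesIco

variable {f : ℝ → ℝ} {c : ℝ} (hmono : MonotoneOn f (Ico 0 1))
  (hnonneg : ∀ u ∈ Ico (0 : ℝ) 1, 0 ≤ f u) (hle : ∀ u ∈ Ico (0 : ℝ) 1, f u ≤ c)
  (hright : ∀ u ∈ Ico (0 : ℝ) 1, ContinuousWithinAt f (Ici u) u)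

theorem tendsto_extendIco_atBot : Tendsto (extendIco f c) atBot (𝓝 0) :=
  tendsto_const_nhds.congr' <| by
    filter_upwards [eventually_lt_atBot 0] with u hu using (extendIco_of_lt_zero f c hu).symm

theorem tendsto_extendIco_atTop : Tendsto (extendIco f c) atTop (𝓝 c) :=
  tendsto_const_nhds.congr' <| by
    filter_upwards [eventually_ge_atTop 1] with u hu using (extendIco_of_one_le f c hu).symm

theorem measure_stieltjesIco_Iic (u : ℝ) :
    (stieltjesIco f c hmono hnonneg hle hright).measure (Iic u) =
      ENNReal.ofReal (extendIco f c u) := by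
  rw [StieltjesFunction.measure_Iic _ tendsto_extendIco_atBot, sub_zero]
  rfl

theorem measure_stieltjesIco_univ :
    (stieltjesIco f c hmono hnonneg hle hright).measure univ = ENNReal.ofReal c := by
  rw [StieltjesFunction.measure_univ _ tendsto_extendIco_atBot tendsto_extendIco_atTop, sub_zero]

theorem measure_stieltjesIco_Iio_zero :
    (stieltjesIco f c hmono hnonneg hle hright).measure (Iio 0) = 0 := by
  have h : Function.leftLim (extendIco f c) 0 = 0 := by
    refine leftLim_eq_of_tendsto (tendsto_const_nhds.congr' ?_)
    filter_upwards [self_mem_nhdsWithin] with u hu using (extendIco_of_lt_zero f c hu).symm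
  rw [StieltjesFunction.measure_Iio _ tendsto_extendIco_atBot, sub_zero]
  change ENNReal.ofReal (Function.leftLim (extendIco f c) 0) = 0
  rw [h, ENNReal.ofReal_zero]

end stieltjesIco

namespace SpectralFunction

variable (σ : SpectralFunction)

instance : IsFiniteMeasure σ.smallGamma :=
  ⟨by rw [smallGamma, measure_stieltjesIco_univ]; exact ENNReal.ofReal_lt_top⟩

instance : IsFiniteMeasure σ.bigGamma :=
  ⟨by rw [bigGamma, measure_stieltjesIco_univ]; exact ENNReal.ofReal_lt_top⟩

/-- The total mass was chosen as the supremum of `σ`, which is its left limit at `1`, so there is no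
atom at `1`. -/
theorem smallGamma_Ici_one : σ.smallGamma (Ici 1) = 0 := by
  rw [smallGamma, StieltjesFunction.measure_Ici _ tendsto_extendIco_atTop, ENNReal.ofReal_eq_zero,
    sub_nonpos]
  refine csSup_le ((nonempty_Ico.2 zero_lt_one).image _) ?_
  rintro _ ⟨u, hu, rfl⟩
  have h := (stieltjesIco σ.toFun (sSup (σ.toFun '' Ico 0 1)) σ.monotoneOn σ.nonneg
    (fun _ hu => le_csSup σ.bounded (mem_image_of_mem _ hu)) σ.rightContinuous).mono.le_leftLim hu.2
  exact (extendIco_of_mem σ.toFun (sSup (σ.toFun '' Ico 0 1)) hu).ge.trans h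

theorem ae_mem_Ico_smallGamma : ∀ᵐ u ∂σ.smallGamma, u ∈ Ico (0 : ℝ) 1 := by
  have h1 : ∀ᵐ u ∂σ.smallGamma, u ∉ Ici (1 : ℝ) := measure_eq_zero_iff_ae_notMem.1 σ.smallGamma_Ici_one
  have h2 : ∀ᵐ u ∂σ.smallGamma, u ∉ Iio (0 : ℝ) :=
    measure_eq_zero_iff_ae_notMem.1 (measure_stieltjesIco_Iio_zero _ _ _ _)
  filter_upwards [h1, h2] with u hu1 hu2
  exact ⟨not_lt.1 hu2, not_le.1 hu1⟩

/-- Splitting at `t = u` produces the two terms of `bigGammaCdf`; for `u ≥ 1` the normalization of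
`σ` enters. The left side is what the layer cake formula gives for `∫ (1 - v) dγ_σ(v)` over `v ≤ u`.
-/
theorem integral_extendIco_min (c u : ℝ) :
    ∫ t in (0 : ℝ)..1, extendIco σ.toFun c (min u t) = extendIco σ.bigGammaCdf 1 u := by
  rcases lt_or_ge u 0 with hu | hu
  · have h (t : ℝ) : extendIco σ.toFun c (min u t) = 0 :=
      extendIco_of_lt_zero _ _ (min_lt_of_left_lt hu)
    simp [h, extendIco_of_lt_zero _ _ hu]
  have hcongr {v : ℝ} (hv0 : 0 ≤ v) (hv1 : v ≤ 1) (hvu : v ≤ u) :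
      ∫ t in (0 : ℝ)..v, extendIco σ.toFun c (min u t) = ∫ t in (0 : ℝ)..v, σ.toFun t := by
    refine intervalIntegral.integral_congr_Ioo_of_le hv0 fun t ht => ?_
    rw [min_eq_right (ht.2.le.trans hvu), extendIco_of_mem _ _ ⟨ht.1.le, ht.2.trans_le hv1⟩]
  rcases lt_or_ge u 1 with hu1 | hu1
  · have hcongr2 : ∫ t in u..1, extendIco σ.toFun c (min u t) = ∫ _ in u..1, σ.toFun u := by
      refine intervalIntegral.integral_congr fun t ht => ?_
      rw [uIcc_of_le hu1.le] at ht
      rw [min_eq_left ht.1, extendIco_of_mem _ _ ⟨hu, hu1⟩]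
    have hi1 : IntervalIntegrable (fun t => extendIco σ.toFun c (min u t)) volume 0 u := by
      refine (σ.intervalIntegrable_of_mem (u := 0) (v := u) (by simp) ⟨hu, hu1.le⟩).congr ?_
      intro t ht
      rw [uIoc_of_le hu] at ht
      simp only
      rw [min_eq_right ht.2, extendIco_of_mem _ _ ⟨ht.1.le, ht.2.trans_lt hu1⟩]
    have hi2 : IntervalIntegrable (fun t => extendIco σ.toFun c (min u t)) volume u 1 := by
      refine (intervalIntegrable_const (c := σ.toFun u)).congr ?_
      intro t ht
      rw [uIoc_of_le hu1.le] at ht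
      simp only
      rw [min_eq_left ht.1.le, extendIco_of_mem _ _ ⟨hu, hu1⟩]
    rw [← intervalIntegral.integral_add_adjacent_intervals hi1 hi2, hcongr hu hu1.le le_rfl,
      hcongr2, extendIco_of_mem _ _ ⟨hu, hu1⟩, bigGammaCdf]
    simp [add_comm]
  · rw [hcongr zero_le_one le_rfl hu1, σ.integral_eq_one, extendIco_of_one_le _ _ hu1]

/-- `dΓ_σ(u) = (1 - u) dγ_σ(u)`. -/
theorem bigGamma_eq_withDensity :
    σ.bigGamma = σ.smallGamma.withDensity fun u => ENNReal.ofReal (1 - u) := by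
  refine Measure.ext_of_Iic _ _ fun u => ?_
  set c := sSup (σ.toFun '' Ico 0 1)
  have hnn : 0 ≤ᵐ[σ.smallGamma.restrict (Iic u)] fun v => 1 - v := by
    filter_upwards [ae_restrict_of_ae σ.ae_mem_Ico_smallGamma] with v hv using sub_nonneg.2 hv.2.le
  have hmeas (t : ℝ) : (σ.smallGamma.restrict (Iic u)) {v | t ≤ 1 - v} =
      ENNReal.ofReal (extendIco σ.toFun c (min u (1 - t))) := by
    have h : {v | t ≤ 1 - v} = Iic (1 - t) := by ext v; simp [le_sub_comm]
    rw [h, Measure.restrict_apply measurableSet_Iic, Iic_inter_Iic, min_comm]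
    exact measure_stieltjesIco_Iic _ _ _ _ _
  have hmono : Monotone (extendIco σ.toFun c) := extendIco_monotone σ.monotoneOn σ.nonneg
    fun _ hu => le_csSup σ.bounded (mem_image_of_mem _ hu)
  have hnonneg (v : ℝ) : 0 ≤ extendIco σ.toFun c v := by
    rw [← extendIco_of_lt_zero σ.toFun c (u := min v (-1)) (by simp)]
    exact hmono (min_le_left _ _)
  -- Layer cake for `v ↦ 1 - v`. Levels `t > 1` contribute nothing, since `1 - v ≥ t` forces `v <
  -- 0`; on `(0, 1]` substitute `1 - t` for `t`.
  rw [withDensity_apply _ measurableSet_Iic, lintegral_eq_lintegral_meas_le _ hnn (by fun_prop)]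
  simp_rw [hmeas]
  rw [← Ioc_union_Ioi_eq_Ioi zero_le_one, lintegral_union measurableSet_Ioi (by simp),
    setLIntegral_congr_fun (g := fun _ => 0) measurableSet_Ioi]
  swap
  · intro t ht
    simp only
    rw [extendIco_of_lt_zero _ _ (min_lt_of_right_lt (by simpa using ht)), ENNReal.ofReal_zero]
  have hanti : Antitone fun t : ℝ => extendIco σ.toFun c (min u (1 - t)) := fun s t hst =>
    hmono (min_le_min_left _ (by linarith))
  rw [lintegral_zero, add_zero, ← ofReal_integral_eq_lintegral_ofReal
    ((hanti.antitoneOn _).intervalIntegrable.1)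
    (Eventually.of_forall fun t => hnonneg _), ← intervalIntegral.integral_of_le zero_le_one,
    intervalIntegral.integral_comp_sub_left (fun t => extendIco σ.toFun c (min u t)), sub_self,
    sub_zero, integral_extendIco_min]
  exact measure_stieltjesIco_Iic _ _ _ _ _

end SpectralFunction

/-! ### Semicontinuity of integrals under weak convergence -/

/-- The integral of a lower semicontinuous function, cut off at `0`, is lower semicontinuous for the
weak convergence of probability measures. -/
theorem LowerSemicontinuous.lintegral_ofReal {Ω : Type*} [TopologicalSpace Ω]
    [TopologicalSpace.PseudoMetrizableSpace Ω] [TopologicalSpace.SeparableSpace Ω]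
    [MeasurableSpace Ω] [BorelSpace Ω] {f : Ω → ℝ}
    (hf : LowerSemicontinuous f) (hf0 : 0 ≤ f) :
    LowerSemicontinuous fun π : ProbabilityMeasure Ω =>
      ∫⁻ w, ENNReal.ofReal (f w) ∂(π : Measure Ω) := by
  let : PseudoMetricSpace Ω := TopologicalSpace.pseudoMetrizableSpacePseudoMetric Ω
  refine lowerSemicontinuous_iff_le_liminf.2 fun π => ?_
  -- Layer cake reduces the claim to the open sets `{t < f}`: portmanteau at each level, then Fatou
  -- in `t`.
  simp_rw [lintegral_eq_lintegral_meas_lt _ (Eventually.of_forall hf0) hf.measurable.aemeasurable]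
  calc ∫⁻ t in Ioi (0 : ℝ), (π : Measure Ω) {w | t < f w}
      ≤ ∫⁻ t in Ioi (0 : ℝ),
          liminf (fun π' : ProbabilityMeasure Ω => (π' : Measure Ω) {w | t < f w}) (𝓝 π) :=
        lintegral_mono fun t =>
          ProbabilityMeasure.le_liminf_measure_open_of_tendsto tendsto_id (hf.isOpen_preimage t)
    _ ≤ _ := lintegral_liminf_le fun π' => Antitone.measurable fun s t hst =>
        measure_mono fun w hw => lt_of_le_of_lt hst hw

/-- The integral of a nonpositive upper semicontinuous function is upper semicontinuous on each set
of probability measures for which the function is integrable. -/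
theorem UpperSemicontinuous.integral_of_nonpos {Ω : Type*} [TopologicalSpace Ω]
    [TopologicalSpace.PseudoMetrizableSpace Ω] [TopologicalSpace.SeparableSpace Ω]
    [MeasurableSpace Ω] [BorelSpace Ω] {f : Ω → ℝ}
    (hf : UpperSemicontinuous f) (hf0 : f ≤ 0) {K : Set (ProbabilityMeasure Ω)}
    (hK : ∀ π ∈ K, Integrable f (π : Measure Ω)) :
    UpperSemicontinuousOn (fun π : ProbabilityMeasure Ω => ∫ w, f w ∂(π : Measure Ω)) K := by
  intro π hπ c hc
  have hle (π' : ProbabilityMeasure Ω) : ∫ w, f w ∂(π' : Measure Ω) ≤ 0 := integral_nonpos hf0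
  -- A positive `c` is separated off because `ENNReal.ofReal (-c)` would collapse to `0`.
  rcases lt_or_ge 0 c with h0 | h0
  · exact Eventually.of_forall fun π' => (hle π').trans_lt h0
  have hlsc : LowerSemicontinuous (-f) :=
    continuous_neg.comp_upperSemicontinuous_antitone hf fun _ _ h => neg_le_neg h
  have hnn : 0 ≤ -f := fun w => neg_nonneg.2 (hf0 w)
  have heq : ∀ π' ∈ K, ∫⁻ w, ENNReal.ofReal ((-f) w) ∂(π' : Measure Ω) =
      ENNReal.ofReal (-∫ w, f w ∂(π' : Measure Ω)) := fun π' hπ' => by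
    rw [← ofReal_integral_eq_lintegral_ofReal (hK π' hπ').neg (Eventually.of_forall hnn),
      ← integral_neg]
    rfl
  have h := hlsc.lintegral_ofReal hnn π (ENNReal.ofReal (-c)) (by
    change _ < ∫⁻ w, ENNReal.ofReal ((-f) w) ∂(π : Measure Ω)
    rw [heq π hπ]
    exact (ENNReal.ofReal_lt_ofReal_iff_of_nonneg (neg_nonneg.2 h0)).2 (neg_lt_neg hc))
  filter_upwards [mem_nhdsWithin_of_mem_nhds h, self_mem_nhdsWithin] with π' h1 hπ'
  have h2 : ENNReal.ofReal (-c) < ∫⁻ w, ENNReal.ofReal ((-f) w) ∂(π' : Measure Ω) := h1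
  rw [heq π' hπ', ENNReal.ofReal_lt_ofReal_iff_of_nonneg (neg_nonneg.2 h0)] at h2
  exact neg_lt_neg_iff.1 h2

/-! ### Couplings -/

section couplings

variable {X Y : Type*} [MeasurableSpace X] [MeasurableSpace Y] {μ : ProbabilityMeasure X}
  {ν : ProbabilityMeasure Y} {π : ProbabilityMeasure (X × Y)}

theorem measurePreserving_fst_of_mem_couplings (hπ : π ∈ couplings μ ν) :
    MeasurePreserving Prod.fst (π : Measure (X × Y)) (μ : Measure X) :=
  ⟨measurable_fst, hπ.1⟩

theorem measurePreserving_snd_of_mem_couplings (hπ : π ∈ couplings μ ν) :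
    MeasurePreserving Prod.snd (π : Measure (X × Y)) (ν : Measure Y) :=
  ⟨measurable_snd, hπ.2⟩

theorem ForAEPair.ae_of_mem_couplings {P : X → Y → Prop} (h : ForAEPair μ ν P)
    (hπ : π ∈ couplings μ ν) : ∀ᵐ w ∂(π : Measure (X × Y)), P w.1 w.2 := by
  obtain ⟨S, hS, T, hT, h⟩ := h
  filter_upwards [(measurePreserving_fst_of_mem_couplings hπ).quasiMeasurePreserving.ae hS,
    (measurePreserving_snd_of_mem_couplings hπ).quasiMeasurePreserving.ae hT] with w h1 h2
  exact h _ h1 _ h2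

theorem integrable_add_of_mem_couplings {A : X → ℝ} {B : Y → ℝ} (hA : Integrable A (μ : Measure X))
    (hB : Integrable B (ν : Measure Y)) (hπ : π ∈ couplings μ ν) :
    Integrable (fun w => A w.1 + B w.2) (π : Measure (X × Y)) :=
  ((measurePreserving_fst_of_mem_couplings hπ).integrable_comp_of_integrable hA).add
    ((measurePreserving_snd_of_mem_couplings hπ).integrable_comp_of_integrable hB)

theorem integral_add_of_mem_couplings {A : X → ℝ} {B : Y → ℝ} (hA : Integrable A (μ : Measure X))
    (hB : Integrable B (ν : Measure Y)) (hπ : π ∈ couplings μ ν) :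
    ∫ w, A w.1 + B w.2 ∂(π : Measure (X × Y)) =
      ∫ x, A x ∂(μ : Measure X) + ∫ y, B y ∂(ν : Measure Y) := by
  have h1 := measurePreserving_fst_of_mem_couplings hπ
  have h2 := measurePreserving_snd_of_mem_couplings hπ
  rw [integral_add (f := fun w : X × Y => A w.1) (g := fun w : X × Y => B w.2)
      (h1.integrable_comp_of_integrable hA) (h2.integrable_comp_of_integrable hB),
    ← h1.map_eq, ← h2.map_eq, integral_map h1.aemeasurable, integral_map h2.aemeasurable]
  · rw [h2.map_eq]; exact hB.1
  · rw [h1.map_eq]; exact hA.1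

theorem couplings_nonempty (μ : ProbabilityMeasure X) (ν : ProbabilityMeasure Y) :
    (couplings μ ν).Nonempty :=
  ⟨μ.prod ν, by simp [couplings]⟩

/-- Mixtures of couplings are couplings, and integrals are affine in the coupling. -/
theorem exists_mem_couplings_integral_eq {π₁ π₂ : ProbabilityMeasure (X × Y)}
    (h₁ : π₁ ∈ couplings μ ν) (h₂ : π₂ ∈ couplings μ ν) {a b : ℝ} (ha : 0 ≤ a) (hb : 0 ≤ b)
    (hab : a + b = 1) : ∃ π ∈ couplings μ ν, ∀ f : X × Y → ℝ,
      Integrable f (π₁ : Measure (X × Y)) → Integrable f (π₂ : Measure (X × Y)) →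
      ∫ w, f w ∂(π : Measure (X × Y)) =
        a * ∫ w, f w ∂(π₁ : Measure (X × Y)) + b * ∫ w, f w ∂(π₂ : Measure (X × Y)) := by
  have hab' : ENNReal.ofReal a + ENNReal.ofReal b = 1 := by
    rw [← ENNReal.ofReal_add ha hb, hab, ENNReal.ofReal_one]
  let ρ : Measure (X × Y) :=
    ENNReal.ofReal a • (π₁ : Measure (X × Y)) + ENNReal.ofReal b • (π₂ : Measure (X × Y))
  have hρ : IsProbabilityMeasure ρ := ⟨by simp [ρ, hab']⟩
  refine ⟨⟨ρ, hρ⟩, ⟨?_, ?_⟩, fun f hf₁ hf₂ => ?_⟩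
  · change Measure.map Prod.fst ρ = _
    rw [Measure.map_add _ _ measurable_fst, Measure.map_smul, Measure.map_smul,
      (measurePreserving_fst_of_mem_couplings h₁).map_eq,
      (measurePreserving_fst_of_mem_couplings h₂).map_eq, ← add_smul, hab', one_smul]
  · change Measure.map Prod.snd ρ = _
    rw [Measure.map_add _ _ measurable_snd, Measure.map_smul, Measure.map_smul,
      (measurePreserving_snd_of_mem_couplings h₁).map_eq,
      (measurePreserving_snd_of_mem_couplings h₂).map_eq, ← add_smul, hab', one_smul]
  · change ∫ w, f w ∂ρ = _
    rw [integral_add_measure (hf₁.smul_measure ENNReal.ofReal_ne_top)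
      (hf₂.smul_measure ENNReal.ofReal_ne_top), integral_smul_measure, integral_smul_measure,
      ENNReal.toReal_ofReal ha, ENNReal.toReal_ofReal hb, smul_eq_mul, smul_eq_mul]

variable [TopologicalSpace X] [PolishSpace X] [BorelSpace X]
  [TopologicalSpace Y] [PolishSpace Y] [BorelSpace Y]

/-- Pushforward along a projection is weakly continuous, so the set is closed; a single measure on a
Polish space is tight, and tight marginals make the couplings tight. Prokhorov concludes. -/
theorem isCompact_couplings (μ : ProbabilityMeasure X) (ν : ProbabilityMeasure Y) :
    IsCompact (couplings μ ν) := by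
  have hclosed : IsClosed (couplings μ ν) := by
    have h : couplings μ ν =
        {π | π.map measurable_fst.aemeasurable = μ} ∩
          {π | π.map measurable_snd.aemeasurable = ν} := by
      ext π
      exact and_congr (Subtype.ext_iff (a1 := π.map measurable_fst.aemeasurable)).symm
        (Subtype.ext_iff (a1 := π.map measurable_snd.aemeasurable)).symm
    rw [h]
    exact (isClosed_eq (ProbabilityMeasure.continuous_map continuous_fst) continuous_const).inter
      (isClosed_eq (ProbabilityMeasure.continuous_map continuous_snd) continuous_const)
  rw [← hclosed.closure_eq]
  refine isCompact_closure_of_isTightMeasureSet (IsTightMeasureSet.prodMk ?_ ?_)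
  · refine (isTightMeasureSet_singleton (μ := (μ : Measure X))).subset ?_
    rintro _ ⟨_, ⟨π, hπ, rfl⟩, rfl⟩
    exact hπ.1
  · refine (isTightMeasureSet_singleton (μ := (ν : Measure Y))).subset ?_
    rintro _ ⟨_, ⟨π, hπ, rfl⟩, rfl⟩
    exact hπ.2

/-- The integral of an upper semicontinuous function is upper semicontinuous on the set of couplings,
if it is bounded above by a sum of lower semicontinuous integrable functions of one variable. -/
theorem UpperSemicontinuous.integral_couplings {f : X × Y → ℝ} (hf : UpperSemicontinuous f)
    {A : X → ℝ} {B : Y → ℝ} (hA : LowerSemicontinuous A) (hB : LowerSemicontinuous B)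
    (hAi : Integrable A (μ : Measure X)) (hBi : Integrable B (ν : Measure Y))
    (hle : ForAEPair μ ν fun x y => f (x, y) ≤ A x + B y)
    (hfi : ∀ π ∈ couplings μ ν, Integrable f (π : Measure (X × Y))) :
    UpperSemicontinuousOn (fun π : ProbabilityMeasure (X × Y) => ∫ w, f w ∂(π : Measure (X × Y)))
      (couplings μ ν) := by
  let g : X × Y → ℝ := fun w => A w.1 + B w.2
  have hg : LowerSemicontinuous g := (hA.comp continuous_fst).add (hB.comp continuous_snd)
  have hng : UpperSemicontinuous fun w => -g w :=
    continuous_neg.comp_lowerSemicontinuous_antitone hg fun _ _ h => neg_le_neg h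
  -- The bound `f ≤ g` holds only almost everywhere; the cut at `0` makes it hold everywhere without
  -- changing any integral against a coupling.
  have hh : UpperSemicontinuous fun w => min (f w + -g w) 0 :=
    (hf.add hng).inf upperSemicontinuous_const
  have hae (π) (hπ : π ∈ couplings μ ν) :
      (fun w => min (f w + -g w) 0) =ᵐ[(π : Measure (X × Y))] fun w => f w - g w := by
    filter_upwards [hle.ae_of_mem_couplings hπ] with w hw
    rw [← sub_eq_add_neg, min_eq_left (sub_nonpos.2 hw)]
  have hgi (π) (hπ : π ∈ couplings μ ν) := integrable_add_of_mem_couplings hAi hBi hπ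
  have husc := (hh.integral_of_nonpos (fun w => min_le_right _ _)
    fun π hπ => ((hfi π hπ).sub (hgi π hπ)).congr (hae π hπ).symm).add
      (upperSemicontinuousOn_const
        (z := ∫ x, A x ∂(μ : Measure X) + ∫ y, B y ∂(ν : Measure Y)))
  have heq (π) (hπ : π ∈ couplings μ ν) : ∫ w, min (f w + -g w) 0 ∂(π : Measure (X × Y)) +
      (∫ x, A x ∂(μ : Measure X) + ∫ y, B y ∂(ν : Measure Y)) = ∫ w, f w ∂(π : Measure (X × Y)) := by
    rw [integral_congr_ae (hae π hπ), integral_sub (hfi π hπ) (hgi π hπ),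
      integral_add_of_mem_couplings hAi hBi hπ, sub_add_cancel]
  intro π hπ c hc
  have h := husc π hπ c (by simpa only [heq π hπ] using hc)
  filter_upwards [h, self_mem_nhdsWithin] with π' h1 hπ'
  simpa only [heq π' hπ'] using h1

end couplings

/-! ### The function `G_β` -/

/-- The function `x ↦ ∫ (x - β(u))₊ dg(u)`. -/
noncomputable def integralPosPart (g : Measure ℝ) (β : ℝ → ℝ) (x : ℝ) : ℝ :=
  ∫ u, max (x - β u) 0 ∂g

section integralPosPart

variable {g : Measure ℝ} [IsFiniteMeasure g] {β : ℝ → ℝ}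

theorem integrable_posPart_sub (hβ : Integrable β g) (x : ℝ) :
    Integrable (fun u => max (x - β u) 0) g :=
  ((integrable_const x).sub hβ).pos_part

theorem monotone_integralPosPart (hβ : Integrable β g) : Monotone (integralPosPart g β) :=
  fun x y hxy => integral_mono (integrable_posPart_sub hβ x) (integrable_posPart_sub hβ y)
    fun u => max_le_max_right 0 (sub_le_sub_right hxy (β u))

theorem integralPosPart_le_add (hβ : Integrable β g) (x y : ℝ) :
    integralPosPart g β x ≤ integralPosPart g β y + g.real univ * |x - y| := by
  have h : ∫ _, |x - y| ∂g = g.real univ * |x - y| := by simp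
  rw [← h, integralPosPart, integralPosPart,
    ← integral_add (integrable_posPart_sub hβ y) (integrable_const _)]
  refine integral_mono (integrable_posPart_sub hβ x)
    ((integrable_posPart_sub hβ y).add (integrable_const _)) fun u => max_le ?_ ?_
  · linarith [le_max_left (y - β u) 0, le_abs_self (x - y)]
  · exact add_nonneg (le_max_right _ _) (abs_nonneg _)

theorem continuous_integralPosPart (hβ : Integrable β g) : Continuous (integralPosPart g β) :=
  (LipschitzWith.of_le_add_mul ⟨g.real univ, measureReal_nonneg⟩
    fun x y => integralPosPart_le_add hβ x y).continuous

/-- Transfers a bound `L ≤ A + B` to `G_β ∘ L`, by monotonicity and the Lipschitz bound. Positive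
parts keep the variables separate and depend monotonically and continuously on `y` and `z`, so lower
semicontinuity survives. -/
theorem integralPosPart_le_of_le_add (hβ : Integrable β g) {x y z : ℝ} (h : x ≤ y + z) :
    integralPosPart g β x ≤
      (integralPosPart g β 0 + g.real univ * max y 0) + g.real univ * max z 0 := by
  have h0 : 0 ≤ max y 0 + max z 0 := add_nonneg (le_max_right _ _) (le_max_right _ _)
  have h1 : x ≤ max y 0 + max z 0 := h.trans (add_le_add (le_max_left _ _) (le_max_left _ _))
  refine (monotone_integralPosPart hβ h1).trans ((integralPosPart_le_add hβ _ 0).trans ?_)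
  rw [sub_zero, abs_of_nonneg h0, mul_add, add_assoc]

variable {W : Type*} [MeasurableSpace W] {ρ : Measure W} [IsFiniteMeasure ρ] {L : W → ℝ}

theorem integrable_prod_posPart_sub (hL : Integrable L ρ) (hβ : Integrable β g) :
    Integrable (fun p : W × ℝ => max (L p.1 - β p.2) 0) (ρ.prod g) :=
  ((hL.comp_fst g).sub (hβ.comp_snd ρ)).pos_part

end integralPosPart

/-! ### The functional `H` as an integral against `γ_σ` -/

namespace SpectralFunction

variable (σ : SpectralFunction) {W : Type*} [MeasurableSpace W] {L : W → ℝ}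
  {π : ProbabilityMeasure W} {β : ℝ → ℝ}

/-- The density of `Γ_σ` cancels `(1 - u)⁻¹`, as `γ_σ`-almost every `u` is below `1`. -/
theorem smul_lossIntegrand_ae_eq : (fun u => (ENNReal.ofReal (1 - u)).toReal • lossIntegrand L π β u)
    =ᵐ[σ.smallGamma] fun u => (1 - u) * β u + ∫ w, max (L w - β u) 0 ∂(π : Measure W) := by
  filter_upwards [σ.ae_mem_Ico_smallGamma] with u hu
  have h : 1 - u ≠ 0 := (sub_pos.2 hu.2).ne'
  rw [ENNReal.toReal_ofReal (sub_pos.2 hu.2).le, lossIntegrand, smul_eq_mul, mul_add,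
    mul_inv_cancel_left₀ h]

theorem integrable_one_sub_mul (hβ : β ∈ σ.L1) :
    Integrable (fun u => (1 - u) * β u) σ.smallGamma := by
  refine Integrable.mono hβ ((by fun_prop : AEStronglyMeasurable (fun u : ℝ => 1 - u) _).mul hβ.1) ?_
  filter_upwards [σ.ae_mem_Ico_smallGamma] with u hu
  rw [norm_mul]
  refine mul_le_of_le_one_left (norm_nonneg _) ?_
  rw [Real.norm_of_nonneg (sub_nonneg.2 hu.2.le)]
  linarith [hu.1]

theorem integrable_lossIntegrand (hL : Integrable L (π : Measure W)) (hβ : β ∈ σ.L1) :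
    Integrable (lossIntegrand L π β) σ.bigGamma := by
  rw [bigGamma_eq_withDensity, integrable_withDensity_iff_integrable_smul' (by fun_prop)
    (Eventually.of_forall fun _ => ENNReal.ofReal_lt_top),
    integrable_congr σ.smul_lossIntegrand_ae_eq]
  exact (σ.integrable_one_sub_mul hβ).add (integrable_prod_posPart_sub hL hβ).integral_prod_right

theorem lossH_eq_integral_prod (hL : Integrable L (π : Measure W)) (hβ : β ∈ σ.L1) :
    lossH σ L π β = ∫ u, (1 - u) * β u ∂σ.smallGamma +
      ∫ p : W × ℝ, max (L p.1 - β p.2) 0 ∂((π : Measure W).prod σ.smallGamma) := by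
  have h := integrable_prod_posPart_sub hL hβ
  rw [lossH, bigGamma_eq_withDensity, integral_withDensity_eq_integral_toReal_smul₀ (by fun_prop)
    (Eventually.of_forall fun _ => ENNReal.ofReal_lt_top),
    integral_congr_ae σ.smul_lossIntegrand_ae_eq,
    integral_add (σ.integrable_one_sub_mul hβ) h.integral_prod_right, integral_prod_symm _ h]

theorem integrable_integralPosPart (hL : Integrable L (π : Measure W)) (hβ : β ∈ σ.L1) :
    Integrable (fun w => integralPosPart σ.smallGamma β (L w)) (π : Measure W) :=
  (integrable_prod_posPart_sub hL hβ).integral_prod_left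

theorem lossH_eq_add_integral (hL : Integrable L (π : Measure W)) (hβ : β ∈ σ.L1) :
    lossH σ L π β = ∫ u, (1 - u) * β u ∂σ.smallGamma +
      ∫ w, integralPosPart σ.smallGamma β (L w) ∂(π : Measure W) := by
  rw [σ.lossH_eq_integral_prod hL hβ, integral_prod _ (integrable_prod_posPart_sub hL hβ)]
  rfl

/-- The first term of `H` is linear in `β`, and `(x - β)₊` is convex in `β` pointwise. -/
theorem convexOn_lossH (hL : Integrable L (π : Measure W)) : ConvexOn ℝ σ.L1 (lossH σ L π) := by
  have hconv : Convex ℝ σ.L1 := fun β hβ β' hβ' a b _ _ _ =>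
    (Integrable.smul a hβ).add (Integrable.smul b hβ')
  refine ⟨hconv, fun β hβ β' hβ' a b ha hb hab => ?_⟩
  have h₁ := integrable_prod_posPart_sub hL hβ
  have h₂ := integrable_prod_posPart_sub hL hβ'
  rw [σ.lossH_eq_integral_prod hL hβ, σ.lossH_eq_integral_prod hL hβ',
    σ.lossH_eq_integral_prod hL (hconv hβ hβ' ha hb hab)]
  have hlin : ∫ u, (1 - u) * (a • β + b • β') u ∂σ.smallGamma =
      a * ∫ u, (1 - u) * β u ∂σ.smallGamma + b * ∫ u, (1 - u) * β' u ∂σ.smallGamma := by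
    rw [← integral_const_mul, ← integral_const_mul,
      ← integral_add ((σ.integrable_one_sub_mul hβ).const_mul a)
        ((σ.integrable_one_sub_mul hβ').const_mul b)]
    congr 1 with u
    simp only [Pi.add_apply, Pi.smul_apply, smul_eq_mul]
    ring
  have hle : ∫ p : W × ℝ, max (L p.1 - (a • β + b • β') p.2) 0 ∂((π : Measure W).prod σ.smallGamma) ≤
      a * ∫ p : W × ℝ, max (L p.1 - β p.2) 0 ∂((π : Measure W).prod σ.smallGamma) +
      b * ∫ p : W × ℝ, max (L p.1 - β' p.2) 0 ∂((π : Measure W).prod σ.smallGamma) := by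
    rw [← integral_const_mul, ← integral_const_mul,
      ← integral_add (h₁.const_mul a) (h₂.const_mul b)]
    refine integral_mono (integrable_prod_posPart_sub hL (hconv hβ hβ' ha hb hab))
      ((h₁.const_mul a).add (h₂.const_mul b)) fun p => max_le ?_ ?_
    · have e : L p.1 - (a • β + b • β') p.2 = a * (L p.1 - β p.2) + b * (L p.1 - β' p.2) := by
        simp only [Pi.add_apply, Pi.smul_apply, smul_eq_mul]
        linear_combination -(L p.1) * hab
      rw [e]
      gcongr <;> exact le_max_left _ _
    · positivity
  rw [hlin, smul_eq_mul, smul_eq_mul]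
  linarith

end SpectralFunction

/-! ### The minimax identity -/

theorem mainTheorem7 {X Y : Type*}
    [TopologicalSpace X] [PolishSpace X] [MeasurableSpace X] [BorelSpace X]
    [TopologicalSpace Y] [PolishSpace Y] [MeasurableSpace Y] [BorelSpace Y]
    (μ : ProbabilityMeasure X) (ν : ProbabilityMeasure Y) (σ : SpectralFunction)
    (L : X × Y → ℝ) (hL : UpperSemicontinuous L)
    (hupper : ∃ (A : X → ℝ) (B : Y → ℝ), LowerSemicontinuous A ∧ LowerSemicontinuous B ∧
      Integrable A (μ : Measure X) ∧ Integrable B (ν : Measure Y) ∧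
      ForAEPair μ ν (fun x y => L (x, y) ≤ A x + B y))
    (hlower : ∃ (a : X → ℝ) (b : Y → ℝ), UpperSemicontinuous a ∧ UpperSemicontinuous b ∧
      Integrable a (μ : Measure X) ∧ Integrable b (ν : Measure Y) ∧
      ForAEPair μ ν (fun x y => a x + b y ≤ L (x, y))) :
    -- all the integrals that enter `H` are well defined and finite
    (∀ π ∈ couplings μ ν,
      (∀ b : ℝ, Integrable (fun w => max (L w - b) 0) (π : Measure (X × Y))) ∧
      ∀ β ∈ σ.L1, Integrable (lossIntegrand L π β) σ.bigGamma) ∧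
    -- for every `β`, the maximum over `π` is attained
    (∀ β ∈ σ.L1, ∃ π ∈ couplings μ ν, ∀ π' ∈ couplings μ ν, lossH σ L π' β ≤ lossH σ L π β) ∧
    -- the maximum over `π` of the infimum over `β` is attained
    (∃ π ∈ couplings μ ν, ∀ π' ∈ couplings μ ν,
      (⨅ β ∈ σ.L1, (lossH σ L π' β : EReal)) ≤ ⨅ β ∈ σ.L1, (lossH σ L π β : EReal)) ∧
    -- the two values agree
    (⨅ β ∈ σ.L1, ⨆ π ∈ couplings μ ν, (lossH σ L π β : EReal)) =
      ⨆ π ∈ couplings μ ν, ⨅ β ∈ σ.L1, (lossH σ L π β : EReal) := by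
  obtain ⟨A, B, hA, hB, hAi, hBi, hAB⟩ := hupper
  obtain ⟨a, b, -, -, hai, hbi, hab⟩ := hlower
  have hLi : ∀ π ∈ couplings μ ν, Integrable L (π : Measure (X × Y)) := fun π hπ =>
    integrable_of_le_of_le hL.measurable.aestronglyMeasurable (hab.ae_of_mem_couplings hπ)
      (hAB.ae_of_mem_couplings hπ) (integrable_add_of_mem_couplings hai hbi hπ)
      (integrable_add_of_mem_couplings hAi hBi hπ)
  have husc : ∀ β ∈ σ.L1, UpperSemicontinuousOn (fun π => lossH σ L π β) (couplings μ ν) := by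
    intro β hβ
    have hmono : Monotone fun x : ℝ => σ.smallGamma.real univ * max x 0 := fun x y hxy =>
      mul_le_mul_of_nonneg_left (max_le_max_right 0 hxy) measureReal_nonneg
    have hcont : Continuous fun x : ℝ => σ.smallGamma.real univ * max x 0 := by fun_prop
    have h := ((continuous_integralPosPart hβ).comp_upperSemicontinuous hL
      (monotone_integralPosPart hβ)).integral_couplings (μ := μ) (ν := ν)
      ((lowerSemicontinuous_const (z := integralPosPart σ.smallGamma β 0)).add
        (hcont.comp_lowerSemicontinuous hA hmono))
      (hcont.comp_lowerSemicontinuous hB hmono)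
      ((integrable_const _).add (hAi.pos_part.const_mul _)) (hBi.pos_part.const_mul _)
      (by
        obtain ⟨S, hS, T, hT, h⟩ := hAB
        exact ⟨S, hS, T, hT, fun x hx y hy => integralPosPart_le_of_le_add hβ (h x hx y hy)⟩)
      fun π hπ => σ.integrable_integralPosPart (hLi π hπ) hβ
    have h' := (upperSemicontinuousOn_const (z := ∫ u, (1 - u) * β u ∂σ.smallGamma)).add h
    intro π hπ c hc
    simp only [σ.lossH_eq_add_integral (hLi π hπ) hβ] at hc
    filter_upwards [h' π hπ c hc, self_mem_nhdsWithin] with π' h1 hπ'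
    simp only [σ.lossH_eq_add_integral (hLi π' hπ') hβ]
    exact h1
  have hcompact := isCompact_couplings μ ν
  have hne := couplings_nonempty μ ν
  refine ⟨fun π hπ => ⟨fun b => ((hLi π hπ).sub (integrable_const b)).pos_part,
    fun β hβ => σ.integrable_lossIntegrand (hLi π hπ) hβ⟩,
    fun β hβ => (husc β hβ).exists_isMaxOn hne hcompact, ?_, le_antisymm ?_ ?_⟩
  -- An infimum of upper semicontinuous functions is upper semicontinuous; in `EReal` no lower bound
  -- on it is needed.
  · have h : UpperSemicontinuousOn (fun π => ⨅ β ∈ σ.L1, (lossH σ L π β : EReal))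
        (couplings μ ν) := upperSemicontinuousOn_biInf fun β hβ =>
      continuous_coe_real_ereal.comp_upperSemicontinuousOn (husc β hβ)
        EReal.coe_strictMono.monotone
    exact h.exists_isMaxOn hne hcompact
  · refine iInf_iSup_le_iSup_iInf_of_isCompact hcompact hne husc
      (fun π hπ => σ.convexOn_lossH (hLi π hπ)) fun π₁ h₁ π₂ h₂ s t hs ht hst => ?_
    obtain ⟨π, hπ, h⟩ := exists_mem_couplings_integral_eq h₁ h₂ hs ht hst
    refine ⟨π, hπ, fun β hβ => le_of_eq ?_⟩
    rw [σ.lossH_eq_add_integral (hLi π hπ) hβ, σ.lossH_eq_add_integral (hLi π₁ h₁) hβ,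
      σ.lossH_eq_add_integral (hLi π₂ h₂) hβ, h _ (σ.integrable_integralPosPart (hLi π₁ h₁) hβ)
        (σ.integrable_integralPosPart (hLi π₂ h₂) hβ)]
    linear_combination (∫ u, (1 - u) * β u ∂σ.smallGamma) * hst
  · exact iSup₂_le fun π hπ => iInf₂_mono fun β _ =>
      le_iSup₂ (f := fun π' (_ : π' ∈ couplings μ ν) => (lossH σ L π' β : EReal)) π hπ
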